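/- Let $V$ be a (not necessarily complete) operator space, i.e. a complex vector space with norms $\|\cdot\|_n$ on the matrix spaces $M_n(V)$ satisfying Ruan's axioms. Subspaces and quotients carry their usual operator space structure, $\mathcal T_n=M_n^*$ denotes the operator space of $n\times n$ trace class matrices, so that $M_k(\mathcal T_n)=\mathcal{CB}(M_n,M_k)$, and $$d_{cb}(X,Y)=\inf\{\|\varphi\|_{cb}\|\varphi^{-1}\|_{cb} : \varphi: X\to Y \text{ a linear isomorphism}\}\in[0,\infty].$$ A finite-dimensional operator space $X$ is *$\lambda$-coexact* if for every $\varepsilon>0$ there are $n$ and a subspace $W\subseteq\mathcal T_n$ with $d_{cb}(X,\mathcal T_n/W)<\lambda+\varepsilon$. The operator space $V$ is *$\lambda$-subcoexact* if every finite-dimensional subspace of $V$ is contained in a finite-dimensional $\lambda$-coexact subspace of $V$. A *matrix set* in $V$ is a family $\boldsymbol K=(K_n)_{n}$ of sets $K_n\subseteq M_n(V)$; closures, closedness and inclusions are taken level by level. The matrix set $\boldsymbol K$ is *completely compact* if it is closed, $\sup\{\|x\|_n : n\in\mathbb N,\ x\in K_n\}<\infty$, and for every $\varepsilon>0$ there is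 a finite-dimensional subspace $V_\varepsilon\subseteq V$ such that for all $n$ and all $x\in K_n$ there is $v\in M_n(V_\varepsilon)$ with $\|x-v\|_n<\varepsilon$. Let $M_\infty(V)$ be the space of infinite matrices over $V$ with only finitely many nonzero entries and, for an infinite matrix $x$ over $V$, put $\|x\|=\sup_N\|(x_{ij})_{i,j\le N}\|_N$. Let $\mathcal K(V)$ be the set of infinite matrices $x$ over $V$ that are norm limits of elements of $M_\infty(V)$ (for complete $V$ this is the completion $\mathcal K\otimes V$ of $M_\infty(V)$). For $x\in\mathcal K(V)$ the *absolutely matrix convex hull* $\operatorname{co}x$ is the matrix set $$(\operatorname{co}x)_k=\{(\sigma\otimes\mathrm{id})(x) : \sigma\in M_k(M_\infty),\ \|\sigma\|_{M_k(\mathcal T)}\le 1\}\subseteq M_k(V),\qquad (\sigma\otimes\mathrm{id})(x)_{pq}=\sum_{i,j}(\sigma_{pq})_{ij}\,x_{ij},$$ where $M_\infty=\bigcup_N\mathcal T_N\subseteq\mathcal T$ are the finitely supported scalar matrices. The matrix set $\boldsymbol K$ is *operator compact* if it is closed and $\boldsymbol K\subseteq\overline{\operatorname{co}x}$ for some $x\in\mathcal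 K(V)$. **Theorem.** If $V$ is $\lambda$-subcoexact for some $\lambda<\infty$, then every completely compact matrix set in $V$ is operator compact. -/

import Mathlib

open scoped ENNReal

namespace OpSp

/-- The operator norm of a complex matrix, as a map between finite-dimensional Hilbert spaces. -/
noncomputable def opNorm {m n : Type*} [Fintype m] [Fintype n] [DecidableEq m] [DecidableEq n]
    (A : Matrix m n ℂ) : ℝ :=
  ‖Matrix.toEuclideanLin.trans LinearMap.toContinuousLinearMap A‖

/-- The product `α x β` of a `V`-valued matrix by scalar rectangular matrices. -/
def sandwich {V : Type*} [AddCommGroup V] [Module ℂ V] {m n p : ℕ}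
    (α : Matrix (Fin m) (Fin n) ℂ) (x : Matrix (Fin n) (Fin n) V)
    (β : Matrix (Fin n) (Fin p) ℂ) : Matrix (Fin m) (Fin p) V :=
  fun i j => ∑ k, ∑ l, (α i k * β l j) • x k l

/-- The block diagonal matrix `x ⊕ y`. -/
def directSum {V : Type*} [AddCommGroup V] {m n : ℕ} (x : Matrix (Fin m) (Fin m) V)
    (y : Matrix (Fin n) (Fin n) V) : Matrix (Fin (m + n)) (Fin (m + n)) V :=
  Matrix.reindex finSumFinEquiv finSumFinEquiv (Matrix.fromBlocks x 0 0 y)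

/-- A real-valued function on each of the matrix levels `M_n(V)` (no laws). -/
class MatrixNorm (V : Type*) where
  /-- the value at an element of `M_n(V)` -/
  mnorm : (n : ℕ) → Matrix (Fin n) (Fin n) V → ℝ

open MatrixNorm (mnorm)

/-- A (not necessarily complete) operator space: a complex vector space with norms on all the
spaces `M_n(V)` that satisfy Ruan's axioms. The norm of `V` itself is the one on `M_1(V)`. -/
class OperatorSpace (V : Type*) [AddCommGroup V] [Module ℂ V] extends MatrixNorm V where
  mnorm_eq_zero : ∀ (n : ℕ) (x : Matrix (Fin n) (Fin n) V), mnorm n x = 0 ↔ x = 0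
  mnorm_add_le : ∀ (n : ℕ) (x y : Matrix (Fin n) (Fin n) V),
    mnorm n (x + y) ≤ mnorm n x + mnorm n y
  mnorm_smul : ∀ (n : ℕ) (c : ℂ) (x : Matrix (Fin n) (Fin n) V),
    mnorm n (c • x) = ‖c‖ * mnorm n x
  mnorm_directSum : ∀ (m n : ℕ) (x : Matrix (Fin m) (Fin m) V) (y : Matrix (Fin n) (Fin n) V),
    mnorm (m + n) (directSum x y) = max (mnorm m x) (mnorm n y)
  mnorm_sandwich_le : ∀ (m n : ℕ) (α : Matrix (Fin m) (Fin n) ℂ) (x : Matrix (Fin n) (Fin n) V)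
    (β : Matrix (Fin n) (Fin m) ℂ),
    mnorm m (sandwich α x β) ≤ opNorm α * mnorm n x * opNorm β

/-! ### Completely bounded norms, subspaces and quotients -/

/-- The completely bounded norm `sup_k ‖φ_k‖` of a linear map, where `φ_k = M_k(φ)`;
it is `∞` if `φ` is not completely bounded. -/
noncomputable def cbNorm {V W : Type*} [AddCommGroup V] [Module ℂ V] [MatrixNorm V]
    [AddCommGroup W] [Module ℂ W] [MatrixNorm W] (φ : V →ₗ[ℂ] W) : ℝ≥0∞ :=
  ⨆ (k : ℕ) (x : Matrix (Fin k) (Fin k) V) (_ : mnorm k x ≤ 1), ENNReal.ofReal (mnorm k (x.map φ))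

/-- A linear subspace carries the restricted matrix norms. -/
instance instMatrixNormSubmodule {V : Type*} [AddCommGroup V] [Module ℂ V] [MatrixNorm V]
    (X : Submodule ℂ V) : MatrixNorm X where
  mnorm k x := mnorm k (x.map X.subtype)

/-- A quotient `V / W` carries the quotient norm of `M_k(V) → M_k(V / W)` at each level. -/
noncomputable instance instMatrixNormQuotient {V : Type*} [AddCommGroup V] [Module ℂ V]
    [MatrixNorm V] (W : Submodule ℂ V) : MatrixNorm (V ⧸ W) where
  mnorm k q := sInf {r : ℝ | ∃ y : Matrix (Fin k) (Fin k) V, y.map W.mkQ = q ∧ mnorm k y = r}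

/-- The completely bounded Banach–Mazur distance; it is `∞` if there is no isomorphism. -/
noncomputable def dcb (V W : Type*) [AddCommGroup V] [Module ℂ V] [MatrixNorm V]
    [AddCommGroup W] [Module ℂ W] [MatrixNorm W] : ℝ≥0∞ :=
  ⨅ θ : V ≃ₗ[ℂ] W, cbNorm (θ : V →ₗ[ℂ] W) * cbNorm (θ.symm : W →ₗ[ℂ] V)

/-! ### The operator spaces `M_n` and `T_n` -/

/-- The operator space `M_n`: the norm on `M_k(M_n)` is the operator norm of `kn × kn` matrices. -/
noncomputable instance instMatrixNormMatrix (n : ℕ) : MatrixNorm (Matrix (Fin n) (Fin n) ℂ) where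
  mnorm k x := opNorm (Matrix.comp (Fin k) (Fin k) (Fin n) (Fin n) ℂ x)

/-- The trace class operators `T_n`, written as `n × n` matrices. They form the operator space
dual of `M_n` through the pairing `⟨t, a⟩ = ∑ i j, t i j * a i j`. -/
def TraceClass (n : ℕ) : Type := Matrix (Fin n) (Fin n) ℂ

instance (n : ℕ) : AddCommGroup (TraceClass n) :=
  inferInstanceAs (AddCommGroup (Matrix (Fin n) (Fin n) ℂ))

instance (n : ℕ) : Module ℂ (TraceClass n) :=
  inferInstanceAs (Module ℂ (Matrix (Fin n) (Fin n) ℂ))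

/-- The map `σ ⊗ id : M_n(V) → M_k(V)` given by `σ ∈ M_k(T_n)`. -/
def slice {V : Type*} [AddCommGroup V] [Module ℂ V] {k n : ℕ}
    (σ : Matrix (Fin k) (Fin k) (TraceClass n)) :
    Matrix (Fin n) (Fin n) V →ₗ[ℂ] Matrix (Fin k) (Fin k) V where
  toFun x := Matrix.of fun p q => ∑ i, ∑ j, (σ p q) i j • x i j
  map_add' x y := by
    ext p q
    simp [smul_add, Finset.sum_add_distrib]
  map_smul' c x := by
    ext p q
    simp [Finset.smul_sum, smul_comm c]

/-- The operator space `T_n = M_n^*`: the norm of `σ ∈ M_k(T_n)` is the completely bounded norm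
of the corresponding map `M_n → M_k` (which is always finite). -/
noncomputable instance instMatrixNormTraceClass (n : ℕ) : MatrixNorm (TraceClass n) where
  mnorm k σ := (cbNorm (slice σ : Matrix (Fin n) (Fin n) ℂ →ₗ[ℂ] Matrix (Fin k) (Fin k) ℂ)).toReal

/-! ### Coexactness -/

/-- `V` (finite-dimensional in all uses) is `lam`-coexact. -/
def IsCoexact (lam : ℝ≥0∞) (V : Type*) [AddCommGroup V] [Module ℂ V] [MatrixNorm V] : Prop :=
  ∀ ε : ℝ≥0∞, 0 < ε → ∃ (n : ℕ) (W : Submodule ℂ (TraceClass n)),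
    dcb V (TraceClass n ⧸ W) < lam + ε

/-- `V` is `lam`-subcoexact: each finite-dimensional subspace lies in a finite-dimensional
`lam`-coexact subspace. -/
def IsSubcoexact (lam : ℝ≥0∞) (V : Type*) [AddCommGroup V] [Module ℂ V] [OperatorSpace V] :
    Prop :=
  ∀ F : Submodule ℂ V, FiniteDimensional ℂ F →
    ∃ X : Submodule ℂ V, F ≤ X ∧ FiniteDimensional ℂ X ∧ IsCoexact lam X

/-! ### Matrix sets -/

/-- A matrix set in `V`: a subset of `M_n(V)` for each `n`. -/
abbrev MatrixSet (V : Type*) := (n : ℕ) → Set (Matrix (Fin n) (Fin n) V)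

section MatrixSets

variable {V : Type*} [AddCommGroup V] [Module ℂ V] [OperatorSpace V]

/-- The levelwise norm closure of a matrix set. -/
def MatrixSet.closure (K : MatrixSet V) : MatrixSet V :=
  fun n => {x | ∀ ε : ℝ, 0 < ε → ∃ y ∈ K n, mnorm n (x - y) < ε}

/-- A matrix set is closed if it is norm closed at each level. -/
def MatrixSet.IsClosed (K : MatrixSet V) : Prop := ∀ n, K.closure n ⊆ K n

/-- A completely compact matrix set: closed, completely bounded, and for each `ε > 0`
uniformly within `ε`, at all levels, of a finite-dimensional subspace of `V`. -/
def MatrixSet.IsCompletelyCompact (K : MatrixSet V) : Prop :=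
  K.IsClosed ∧ (∃ C : ℝ, ∀ n, ∀ x ∈ K n, mnorm n x ≤ C) ∧
    ∀ ε : ℝ, 0 < ε → ∃ F : Submodule ℂ V, FiniteDimensional ℂ F ∧
      ∀ n, ∀ x ∈ K n, ∃ v : Matrix (Fin n) (Fin n) V, (∀ i j, v i j ∈ F) ∧ mnorm n (x - v) < ε

/-- The upper left `N × N` block of an infinite matrix. -/
def block (N : ℕ) (x : Matrix ℕ ℕ V) : Matrix (Fin N) (Fin N) V :=
  x.submatrix Fin.val Fin.val

/-- `M_∞(V)`: the infinite matrices with only finitely many nonzero entries. -/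
def IsFinitary (a : Matrix ℕ ℕ V) : Prop := ∃ N : ℕ, ∀ i j, N ≤ i ∨ N ≤ j → a i j = 0

/-- `𝒦(V) = 𝒦 ⊗ V`: the infinite matrices over `V` that are limits of elements of `M_∞(V)` in the
norm `sup_N ‖block N x‖`. For complete `V` this is the completion of `M_∞(V)`; in general it is
the set of those elements of the completion whose entries lie in `V`. -/
def compactMatrices (V : Type*) [AddCommGroup V] [Module ℂ V] [OperatorSpace V] :
    Set (Matrix ℕ ℕ V) :=
  {x | ∀ ε : ℝ, 0 < ε → ∃ a : Matrix ℕ ℕ V, IsFinitary a ∧ ∀ N, mnorm N (block N (x - a)) ≤ ε}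

/-- The absolutely matrix convex hull of `x`: its `k`-th level consists of the `(σ ⊗ id)(x)`,
where `σ` lies in the unit ball of `M_k(M_∞)`. Here `M_∞ ⊆ T` is the union of the `T_N`, and
`σ ∈ M_k(T_N)` only sees the upper left `N × N` block of `x`. -/
def ophull (x : Matrix ℕ ℕ V) : MatrixSet V :=
  fun k => {v | ∃ (N : ℕ) (σ : Matrix (Fin k) (Fin k) (TraceClass N)),
    mnorm k σ ≤ 1 ∧ v = slice σ (block N x)}

/-- An operator compact matrix set: closed, and contained in the closed absolutely matrix convex
hull of a single `x ∈ 𝒦(V)`. -/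
def MatrixSet.IsOperatorCompact (K : MatrixSet V) : Prop :=
  K.IsClosed ∧ ∃ x ∈ compactMatrices V, ∀ n, K n ⊆ (ophull x).closure n

end MatrixSets

end OpSp

/-! Approximating a completely compact set to within `4⁻ʲ` by finite-dimensional subspaces writes
each of its elements as a series `v = ∑ wⱼ` with `‖wⱼ‖ ≤ R 4⁻ʲ`, where `wⱼ` has entries in a
`λ`-coexact subspace `Xⱼ` that depends on `j` but not on `v` (`exists_telescoping`).

Coexactness gives a map from some `T_n` onto `Xⱼ`. Applied to the element of `M_n(T_n)` that
represents the identity of `M_n`, it yields after scaling one contractive matrix `xⱼ`. Lifting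
through the quotient shows that every matrix `w` over `Xⱼ` is `(σ ⊗ id)(xⱼ)` with `‖σ‖ ≤ (λ + 2)‖w‖`
(`exists_slice_of_isCoexact`).

The required element of `𝒦(V)` is the block diagonal matrix with blocks `cⱼ xⱼ`. Its norm is a
maximum over the blocks, so `cⱼ → 0` suffices; the norms of the slicing functionals add, so `∑ ‖σⱼ‖
/ cⱼ ≤ 1` is needed. The decay `4⁻ʲ` leaves room for both with `cⱼ` of order `2⁻ʲ`. Only finiteness
and uniformity of the coexactness constant matter. -/

namespace OpSp

open MatrixNorm (mnorm)

/-! ### Operator norms of scalar matrices. -/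

section OpNorm

open scoped Matrix.Norms.L2Operator

variable {l m n p : Type*} [Fintype l] [Fintype m] [Fintype n] [Fintype p]
  [DecidableEq l] [DecidableEq m] [DecidableEq n] [DecidableEq p]

theorem opNorm_eq_norm (A : Matrix m n ℂ) : opNorm A = ‖A‖ := rfl

theorem opNorm_nonneg (A : Matrix m n ℂ) : 0 ≤ opNorm A := norm_nonneg _

theorem opNorm_add_le (A B : Matrix m n ℂ) : opNorm (A + B) ≤ opNorm A + opNorm B := by
  simpa only [opNorm_eq_norm] using norm_add_le A B

theorem opNorm_smul (c : ℂ) (A : Matrix m n ℂ) : opNorm (c • A) = ‖c‖ * opNorm A := by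
  simpa only [opNorm_eq_norm] using norm_smul c A

theorem opNorm_sum_le {ι : Type*} (s : Finset ι) (A : ι → Matrix m n ℂ) :
    opNorm (∑ i ∈ s, A i) ≤ ∑ i ∈ s, opNorm (A i) := by
  simpa only [opNorm_eq_norm] using norm_sum_le s A

theorem opNorm_mul_le (A : Matrix m n ℂ) (B : Matrix n p ℂ) :
    opNorm (A * B) ≤ opNorm A * opNorm B := by
  simpa only [opNorm_eq_norm] using Matrix.l2_opNorm_mul A B

theorem opNorm_conjTranspose (A : Matrix m n ℂ) : opNorm A.conjTranspose = opNorm A := by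
  simpa only [opNorm_eq_norm] using Matrix.l2_opNorm_conjTranspose A

theorem opNorm_one_le : opNorm (1 : Matrix m m ℂ) ≤ 1 := by
  rw [opNorm_eq_norm, ← Matrix.diagonal_one, Matrix.l2_opNorm_diagonal]
  exact (pi_norm_le_iff_of_nonneg zero_le_one).2 fun i => by simp

/-- A selection of distinct rows is a coisometry `S S* = 1`, so the C*-identity bounds its norm. -/
theorem opNorm_one_submatrix_le {f : m → n} (hf : Function.Injective f) :
    opNorm ((1 : Matrix n n ℂ).submatrix f id) ≤ 1 := by
  have h : ((1 : Matrix n n ℂ).submatrix f id) *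
      ((1 : Matrix n n ℂ).submatrix f id).conjTranspose = 1 := by
    ext i j
    simp [Matrix.mul_apply, Matrix.one_apply, hf.eq_iff, eq_comm]
  have h2 := Matrix.l2_opNorm_conjTranspose_mul_self
    ((1 : Matrix n n ℂ).submatrix f id).conjTranspose
  rw [Matrix.conjTranspose_conjTranspose, h, Matrix.l2_opNorm_conjTranspose] at h2
  have h3 : ‖(1 : Matrix m m ℂ)‖ ≤ 1 := opNorm_one_le
  rw [opNorm_eq_norm]
  nlinarith [norm_nonneg ((1 : Matrix n n ℂ).submatrix f id)]

theorem opNorm_one_submatrix_id_le {f : m → n} (hf : Function.Injective f) :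
    opNorm ((1 : Matrix n n ℂ).submatrix id f) ≤ 1 := by
  have := opNorm_one_submatrix_le hf
  rw [← opNorm_conjTranspose] at this
  simpa using this

theorem opNorm_mul_mul_le {A : Matrix l m ℂ} {B : Matrix n p ℂ} (hA : opNorm A ≤ 1)
    (hB : opNorm B ≤ 1) (X : Matrix m n ℂ) : opNorm (A * X * B) ≤ opNorm X :=
  calc opNorm (A * X * B) ≤ opNorm A * opNorm X * opNorm B :=
        (opNorm_mul_le _ _).trans
          (mul_le_mul_of_nonneg_right (opNorm_mul_le _ _) (opNorm_nonneg _))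
    _ ≤ 1 * opNorm X * 1 := by
        have := opNorm_nonneg X
        have := opNorm_nonneg A
        have := opNorm_nonneg B
        gcongr
    _ = opNorm X := by ring

theorem opNorm_submatrix_le {f : l → m} {g : p → n} (hf : Function.Injective f)
    (hg : Function.Injective g) (X : Matrix m n ℂ) : opNorm (X.submatrix f g) ≤ opNorm X := by
  have h : X.submatrix f g =
      (1 : Matrix m m ℂ).submatrix f id * X * (1 : Matrix n n ℂ).submatrix id g := by
    ext i j
    simp [Matrix.mul_apply, Matrix.one_apply]
  rw [h]
  exact opNorm_mul_mul_le (opNorm_one_submatrix_le hf) (opNorm_one_submatrix_id_le hg) X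

end OpNorm

/-! ### Consequences of Ruan's axioms. -/

section OperatorSpace

variable {V : Type*} [AddCommGroup V] [Module ℂ V] [OperatorSpace V]

theorem mnorm_zero (n : ℕ) : mnorm n (0 : Matrix (Fin n) (Fin n) V) = 0 :=
  (OperatorSpace.mnorm_eq_zero n 0).2 rfl

theorem mnorm_neg {n : ℕ} (x : Matrix (Fin n) (Fin n) V) : mnorm n (-x) = mnorm n x := by
  simpa using OperatorSpace.mnorm_smul n (-1) x

theorem mnorm_nonneg {n : ℕ} (x : Matrix (Fin n) (Fin n) V) : 0 ≤ mnorm n x := by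
  have h := OperatorSpace.mnorm_add_le n x (-x)
  rw [add_neg_cancel, mnorm_zero, mnorm_neg] at h
  linarith

theorem mnorm_submatrix_le {m n : ℕ} {f g : Fin m → Fin n} (hf : Function.Injective f)
    (hg : Function.Injective g) (x : Matrix (Fin n) (Fin n) V) :
    mnorm m (x.submatrix f g) ≤ mnorm n x := by
  have h : x.submatrix f g = sandwich ((1 : Matrix (Fin n) (Fin n) ℂ).submatrix f id) x
      ((1 : Matrix (Fin n) (Fin n) ℂ).submatrix id g) := by
    ext i j
    simp [sandwich, Matrix.one_apply]
  rw [h]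
  refine (OperatorSpace.mnorm_sandwich_le _ _ _ _ _).trans ?_
  have h1 := opNorm_one_submatrix_le hf
  have h2 := opNorm_one_submatrix_id_le hg
  have h3 := mnorm_nonneg x
  calc _ ≤ 1 * mnorm n x * 1 := by
        have := opNorm_nonneg ((1 : Matrix (Fin n) (Fin n) ℂ).submatrix f id)
        have := opNorm_nonneg ((1 : Matrix (Fin n) (Fin n) ℂ).submatrix id g)
        gcongr
    _ = _ := by ring

theorem mnorm_block_mono (x : Matrix ℕ ℕ V) {M N : ℕ} (h : M ≤ N) :
    mnorm M (block M x) ≤ mnorm N (block N x) :=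
  mnorm_submatrix_le (Fin.castLE_injective h) (Fin.castLE_injective h) (block N x)

end OperatorSpace

/-! ### Completely bounded norms. -/

section CbNorm

theorem le_cbNorm {V W : Type*} [AddCommGroup V] [Module ℂ V] [MatrixNorm V]
    [AddCommGroup W] [Module ℂ W] [MatrixNorm W] (φ : V →ₗ[ℂ] W) {k : ℕ}
    (x : Matrix (Fin k) (Fin k) V) (hx : mnorm k x ≤ 1) :
    ENNReal.ofReal (mnorm k (x.map φ)) ≤ cbNorm φ :=
  le_iSup_of_le k <| le_iSup_of_le x <| le_iSup_of_le hx le_rfl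

theorem cbNorm_le {V W : Type*} [AddCommGroup V] [Module ℂ V] [MatrixNorm V]
    [AddCommGroup W] [Module ℂ W] [MatrixNorm W] (φ : V →ₗ[ℂ] W) {C : ℝ≥0∞}
    (h : ∀ (k : ℕ) (x : Matrix (Fin k) (Fin k) V), mnorm k x ≤ 1 →
      ENNReal.ofReal (mnorm k (x.map φ)) ≤ C) : cbNorm φ ≤ C :=
  iSup_le fun k => iSup_le fun x => iSup_le fun hx => h k x hx

theorem cbNorm_comp_le {U V W : Type*} [AddCommGroup U] [Module ℂ U] [MatrixNorm U]
    [AddCommGroup V] [Module ℂ V] [MatrixNorm V]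
    [AddCommGroup W] [Module ℂ W] [MatrixNorm W] (φ : V →ₗ[ℂ] W) (ψ : U →ₗ[ℂ] V)
    (h : ∀ (k : ℕ) (x : Matrix (Fin k) (Fin k) U), mnorm k (x.map ψ) ≤ mnorm k x) :
    cbNorm (φ ∘ₗ ψ) ≤ cbNorm φ :=
  cbNorm_le _ fun k x hx => le_cbNorm φ (x.map ψ) ((h k x).trans hx)

variable {U : Type*} [AddCommGroup U] [Module ℂ U] [MatrixNorm U] {n : ℕ}

theorem mnorm_matrix_nonneg {k : ℕ} (x : Matrix (Fin k) (Fin k) (Matrix (Fin n) (Fin n) ℂ)) :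
    0 ≤ mnorm k x := opNorm_nonneg _

theorem cbNorm_add_le (φ ψ : U →ₗ[ℂ] Matrix (Fin n) (Fin n) ℂ) :
    cbNorm (φ + ψ) ≤ cbNorm φ + cbNorm ψ := by
  refine cbNorm_le _ fun k x hx => ?_
  calc ENNReal.ofReal (mnorm k (x.map (φ + ψ)))
      ≤ ENNReal.ofReal (mnorm k (x.map φ) + mnorm k (x.map ψ)) :=
        ENNReal.ofReal_le_ofReal (opNorm_add_le (Matrix.comp _ _ _ _ ℂ (x.map φ))
          (Matrix.comp _ _ _ _ ℂ (x.map ψ)))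
    _ = _ := ENNReal.ofReal_add (mnorm_matrix_nonneg _) (mnorm_matrix_nonneg _)
    _ ≤ _ := add_le_add (le_cbNorm φ x hx) (le_cbNorm ψ x hx)

theorem cbNorm_smul_le (c : ℂ) (φ : U →ₗ[ℂ] Matrix (Fin n) (Fin n) ℂ) :
    cbNorm (c • φ) ≤ ENNReal.ofReal ‖c‖ * cbNorm φ := by
  refine cbNorm_le _ fun k x hx => ?_
  have h : mnorm k (x.map (c • φ)) = ‖c‖ * mnorm k (x.map φ) :=
    opNorm_smul c (Matrix.comp _ _ _ _ ℂ (x.map φ))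
  rw [h, ENNReal.ofReal_mul (norm_nonneg c)]
  gcongr
  exact le_cbNorm φ x hx

theorem cbNorm_zero : cbNorm (0 : U →ₗ[ℂ] Matrix (Fin n) (Fin n) ℂ) = 0 := by
  simpa using cbNorm_smul_le (0 : ℂ) (0 : U →ₗ[ℂ] Matrix (Fin n) (Fin n) ℂ)

end CbNorm

/-! ### Entries of block diagonal sums. -/

section DirectSum

variable {V : Type*} [AddCommGroup V]

theorem directSum_castAdd_castAdd {m n : ℕ} (x : Matrix (Fin m) (Fin m) V)
    (y : Matrix (Fin n) (Fin n) V) (i j : Fin m) :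
    directSum x y (Fin.castAdd n i) (Fin.castAdd n j) = x i j := by
  simp [directSum]

theorem directSum_castAdd_natAdd {m n : ℕ} (x : Matrix (Fin m) (Fin m) V)
    (y : Matrix (Fin n) (Fin n) V) (i : Fin m) (j : Fin n) :
    directSum x y (Fin.castAdd n i) (Fin.natAdd m j) = 0 := by
  simp [directSum]

theorem directSum_natAdd_castAdd {m n : ℕ} (x : Matrix (Fin m) (Fin m) V)
    (y : Matrix (Fin n) (Fin n) V) (i : Fin n) (j : Fin m) :
    directSum x y (Fin.natAdd m i) (Fin.castAdd n j) = 0 := by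
  simp [directSum]

theorem directSum_natAdd_natAdd {m n : ℕ} (x : Matrix (Fin m) (Fin m) V)
    (y : Matrix (Fin n) (Fin n) V) (i j : Fin n) :
    directSum x y (Fin.natAdd m i) (Fin.natAdd m j) = y i j := by
  simp [directSum]

theorem directSum_sub {m n : ℕ}
    (x x' : Matrix (Fin m) (Fin m) V) (y y' : Matrix (Fin n) (Fin n) V) :
    directSum (x - x') (y - y') = directSum x y - directSum x' y' := by
  ext p q
  refine Fin.addCases (fun p => ?_) (fun p => ?_) p <;>
    refine Fin.addCases (fun q => ?_) (fun q => ?_) q <;>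
    simp [directSum]

end DirectSum

/-! ### Slice maps and the norm of `M_k(T_n)`. -/

section Slice

variable {V : Type*} [AddCommGroup V] [Module ℂ V]

theorem slice_apply {k n : ℕ} (σ : Matrix (Fin k) (Fin k) (TraceClass n))
    (x : Matrix (Fin n) (Fin n) V) (p q : Fin k) :
    slice σ x p q = ∑ i, ∑ j, (σ p q) i j • x i j := rfl

theorem slice_zero {k n : ℕ} :
    (slice (0 : Matrix (Fin k) (Fin k) (TraceClass n)) :
      Matrix (Fin n) (Fin n) V →ₗ[ℂ] _) = 0 := by
  ext x p q
  rw [slice_apply]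
  exact Finset.sum_eq_zero fun i _ => Finset.sum_eq_zero fun j _ => zero_smul ℂ (x i j)

theorem slice_smul {k n : ℕ} (c : ℂ) (σ : Matrix (Fin k) (Fin k) (TraceClass n)) :
    (slice (c • σ) : Matrix (Fin n) (Fin n) V →ₗ[ℂ] _) = c • slice σ := by
  refine LinearMap.ext fun x => ?_
  ext p q
  have h : ∀ i j, (c • σ) p q i j = c * σ p q i j := fun i j => rfl
  simp only [slice_apply, LinearMap.smul_apply, Matrix.smul_apply, Finset.smul_sum, h, mul_smul]

/-- Finiteness ensures that `toReal` in the norm of `M_k(T_n)` loses nothing. The crude bound is the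
sum of the absolute values of all coefficients. -/
theorem cbNorm_slice_lt_top {k n : ℕ} (σ : Matrix (Fin k) (Fin k) (TraceClass n)) :
    cbNorm (slice σ : Matrix (Fin n) (Fin n) ℂ →ₗ[ℂ] Matrix (Fin k) (Fin k) ℂ) < ⊤ := by
  refine lt_of_le_of_lt (cbNorm_le _ (C := ENNReal.ofReal
    (∑ p, ∑ q, ∑ i, ∑ j, ‖σ p q i j‖)) fun m X hX => ENNReal.ofReal_le_ofReal ?_)
    ENNReal.ofReal_lt_top
  let E : Fin k → Matrix (Fin m) (Fin m × Fin k) ℂ :=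
    fun p => (1 : Matrix (Fin m × Fin k) (Fin m × Fin k) ℂ).submatrix (fun a => (a, p)) id
  let F : Fin k → Matrix (Fin m × Fin k) (Fin m) ℂ :=
    fun p => (1 : Matrix (Fin m × Fin k) (Fin m × Fin k) ℂ).submatrix id (fun a => (a, p))
  let Y : Fin n → Fin n → Matrix (Fin m) (Fin m) ℂ := fun i j =>
    (Matrix.comp _ _ _ _ ℂ X).submatrix (fun a => (a, i)) (fun a => (a, j))
  have hinj : ∀ {r : ℕ} (p : Fin r), Function.Injective fun a : Fin m => (a, p) :=
    fun p a b h => (Prod.ext_iff.1 h).1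
  -- `F p * Y i j * E q` places the `(i, j)` block of `X` at position `(p, q)`; each such move is
  -- contractive.
  have key : Matrix.comp _ _ _ _ ℂ (X.map (slice σ)) =
      ∑ p, ∑ q, ∑ i, ∑ j, σ p q i j • (F p * Y i j * E q) := by
    ext ⟨a, p⟩ ⟨b, q⟩
    simp [Matrix.sum_apply, Matrix.mul_apply, Matrix.one_apply, slice_apply, E, F, Y, ite_and,
      Finset.sum_ite_irrel]
  have hterm : ∀ p q i j, opNorm (σ p q i j • (F p * Y i j * E q)) ≤ ‖σ p q i j‖ := by
    intro p q i j
    rw [opNorm_smul]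
    refine mul_le_of_le_one_right (norm_nonneg _) ?_
    exact (opNorm_mul_mul_le (opNorm_one_submatrix_id_le (hinj p))
      (opNorm_one_submatrix_le (hinj q)) _).trans
      ((opNorm_submatrix_le (hinj i) (hinj j) _).trans hX)
  change opNorm (Matrix.comp _ _ _ _ ℂ (X.map (slice σ))) ≤ _
  rw [key]
  refine (opNorm_sum_le _ _).trans (Finset.sum_le_sum fun p _ => ?_)
  refine (opNorm_sum_le _ _).trans (Finset.sum_le_sum fun q _ => ?_)
  refine (opNorm_sum_le _ _).trans (Finset.sum_le_sum fun i _ => ?_)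
  exact (opNorm_sum_le _ _).trans (Finset.sum_le_sum fun j _ => hterm p q i j)

theorem mnorm_traceClass_nonneg {k n : ℕ} (σ : Matrix (Fin k) (Fin k) (TraceClass n)) :
    0 ≤ mnorm k σ := ENNReal.toReal_nonneg

theorem cbNorm_slice {k n : ℕ} (σ : Matrix (Fin k) (Fin k) (TraceClass n)) :
    cbNorm (slice σ : Matrix (Fin n) (Fin n) ℂ →ₗ[ℂ] Matrix (Fin k) (Fin k) ℂ) =
      ENNReal.ofReal (mnorm k σ) :=
  (ENNReal.ofReal_toReal (cbNorm_slice_lt_top σ).ne).symm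

theorem mnorm_traceClass_zero (k n : ℕ) :
    mnorm k (0 : Matrix (Fin k) (Fin k) (TraceClass n)) = 0 := by
  change (cbNorm _).toReal = 0
  rw [slice_zero, cbNorm_zero, ENNReal.toReal_zero]

theorem mnorm_traceClass_smul_le {k n : ℕ} (c : ℂ) (σ : Matrix (Fin k) (Fin k) (TraceClass n)) :
    mnorm k (c • σ) ≤ ‖c‖ * mnorm k σ := by
  have h := cbNorm_smul_le c (slice σ : Matrix (Fin n) (Fin n) ℂ →ₗ[ℂ] _)
  rw [← slice_smul, cbNorm_slice, cbNorm_slice, ← ENNReal.ofReal_mul (norm_nonneg c)] at h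
  exact (ENNReal.ofReal_le_ofReal_iff
    (mul_nonneg (norm_nonneg c) (mnorm_traceClass_nonneg σ))).1 h

/-- The element of `M_n(T_n)` that corresponds to the identity map of `M_n`. -/
def matrixUnits (n : ℕ) : Matrix (Fin n) (Fin n) (TraceClass n) :=
  fun p q => Matrix.single p q (1 : ℂ)

theorem slice_matrixUnits (n : ℕ) :
    (slice (matrixUnits n) : Matrix (Fin n) (Fin n) V →ₗ[ℂ] _) = LinearMap.id := by
  refine LinearMap.ext fun x => ?_
  ext p q
  have h : ∀ i j, matrixUnits n p q i j = if p = i ∧ q = j then (1 : ℂ) else 0 :=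
    fun i j => by simp [matrixUnits, Matrix.single_apply]
  simp [slice_apply, h, ite_and]

theorem mnorm_matrixUnits_le (n : ℕ) : mnorm n (matrixUnits n) ≤ 1 := by
  change (cbNorm _).toReal ≤ 1
  rw [slice_matrixUnits]
  refine ENNReal.toReal_le_of_le_ofReal zero_le_one (cbNorm_le _ fun k x hx => ?_)
  exact ENNReal.ofReal_le_ofReal hx

/-- A linear map `ψ : T_n → V` is given by slicing the matrix of its values at the matrix units. -/
theorem slice_map_matrixUnits {k n : ℕ} (ψ : TraceClass n →ₗ[ℂ] V)
    (σ : Matrix (Fin k) (Fin k) (TraceClass n)) :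
    slice σ ((matrixUnits n).map ψ) = σ.map ψ := by
  ext p q
  have h : σ p q = ∑ i, ∑ j, σ p q i j • matrixUnits n i j := by
    refine (Matrix.matrix_eq_sum_single (σ p q : Matrix (Fin n) (Fin n) ℂ)).trans ?_
    refine Finset.sum_congr rfl fun i _ => Finset.sum_congr rfl fun j _ => ?_
    refine Eq.trans ?_ (Matrix.smul_single (σ p q i j) i j (1 : ℂ)).symm
    simp
  rw [Matrix.map_apply, slice_apply]
  conv_rhs => rw [h]
  simp only [map_sum, map_smul, Matrix.map_apply]

/-- The block diagonal sum of the matrices that represent two maps `M_m → M_k` and `M_n → M_k`. -/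
def traceSum {k m n : ℕ} (σ : Matrix (Fin k) (Fin k) (TraceClass m))
    (τ : Matrix (Fin k) (Fin k) (TraceClass n)) : Matrix (Fin k) (Fin k) (TraceClass (m + n)) :=
  fun p q => directSum (V := ℂ) (σ p q) (τ p q)

theorem sum_directSum_smul {m n : ℕ} (a : Matrix (Fin m) (Fin m) ℂ)
    (b : Matrix (Fin n) (Fin n) ℂ) (x : Matrix (Fin (m + n)) (Fin (m + n)) V) :
    ∑ i, ∑ j, directSum a b i j • x i j =
      (∑ i, ∑ j, a i j • x (Fin.castAdd n i) (Fin.castAdd n j)) +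
        ∑ i, ∑ j, b i j • x (Fin.natAdd m i) (Fin.natAdd m j) := by
  simp [Fin.sum_univ_add, directSum_castAdd_castAdd, directSum_castAdd_natAdd,
    directSum_natAdd_castAdd, directSum_natAdd_natAdd]

theorem slice_traceSum {k m n : ℕ} (σ : Matrix (Fin k) (Fin k) (TraceClass m))
    (τ : Matrix (Fin k) (Fin k) (TraceClass n)) (x : Matrix (Fin (m + n)) (Fin (m + n)) V) :
    slice (traceSum σ τ) x = slice σ (x.submatrix (Fin.castAdd n) (Fin.castAdd n)) +
      slice τ (x.submatrix (Fin.natAdd m) (Fin.natAdd m)) := by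
  ext p q
  exact sum_directSum_smul (σ p q) (τ p q) x

/-- The map represented by the sum is a sum of two maps, each preceded by a completely contractive
compression to a diagonal corner. -/
theorem mnorm_traceSum_le {k m n : ℕ} (σ : Matrix (Fin k) (Fin k) (TraceClass m))
    (τ : Matrix (Fin k) (Fin k) (TraceClass n)) :
    mnorm k (traceSum σ τ) ≤ mnorm k σ + mnorm k τ := by
  let P : ∀ {r : ℕ} (f : Fin r → Fin (m + n)),
      Matrix (Fin (m + n)) (Fin (m + n)) ℂ →ₗ[ℂ] Matrix (Fin r) (Fin r) ℂ := fun f =>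
    { toFun := fun x => x.submatrix f f
      map_add' := fun _ _ => rfl
      map_smul' := fun _ _ => rfl }
  have hP : ∀ {r : ℕ} (f : Fin r → Fin (m + n)), Function.Injective f → ∀ (l : ℕ)
      (x : Matrix (Fin l) (Fin l) (Matrix (Fin (m + n)) (Fin (m + n)) ℂ)),
      mnorm l (x.map (P f)) ≤ mnorm l x := fun f hf l x =>
    opNorm_submatrix_le (f := Prod.map id f) (g := Prod.map id f)
      (Function.injective_id.prodMap hf) (Function.injective_id.prodMap hf)
      (Matrix.comp _ _ _ _ ℂ x)
  have h : (slice (traceSum σ τ) : Matrix (Fin (m + n)) (Fin (m + n)) ℂ →ₗ[ℂ] _) =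
      slice σ ∘ₗ P (Fin.castAdd n) + slice τ ∘ₗ P (Fin.natAdd m) :=
    LinearMap.ext fun x => slice_traceSum σ τ x
  have hle : ENNReal.ofReal (mnorm k (traceSum σ τ)) ≤
      ENNReal.ofReal (mnorm k σ + mnorm k τ) := by
    rw [ENNReal.ofReal_add (mnorm_traceClass_nonneg σ) (mnorm_traceClass_nonneg τ),
      ← cbNorm_slice, ← cbNorm_slice, ← cbNorm_slice, h]
    exact (cbNorm_add_le _ _).trans (add_le_add
      (cbNorm_comp_le _ _ (hP _ (Fin.castAdd_injective m n)))
      (cbNorm_comp_le _ _ (hP _ (Fin.natAdd_injective n m))))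
  exact (ENNReal.ofReal_le_ofReal_iff
    (add_nonneg (mnorm_traceClass_nonneg σ) (mnorm_traceClass_nonneg τ))).1 hle

end Slice

/-! ### Slicing representation over coexact subspaces. -/

section Coexact

variable {V : Type*} [AddCommGroup V] [Module ℂ V] [OperatorSpace V]

/-- The matrices over a coexact subspace are slices of a single contractive matrix, with a
control of the norms that depends only on the coexactness constant. -/
theorem exists_slice_of_isCoexact {lam : ℝ≥0∞} (hlam : lam < ⊤) (X : Submodule ℂ V)
    (hX : IsCoexact lam X) :
    ∃ (n : ℕ) (x : Matrix (Fin n) (Fin n) V), 0 < n ∧ mnorm n x ≤ 1 ∧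
      ∀ (k : ℕ) (w : Matrix (Fin k) (Fin k) V) (d : ℝ), (∀ i j, w i j ∈ X) → 0 < d →
        mnorm k w ≤ d → ∃ σ : Matrix (Fin k) (Fin k) (TraceClass n),
          mnorm k σ ≤ (lam.toReal + 2) * d ∧ slice σ x = w := by
  obtain ⟨n, W, hW⟩ := hX 1 one_pos
  obtain ⟨θ, hθ⟩ := iInf_lt_iff.1 hW
  let ψ : TraceClass n →ₗ[ℂ] V := X.subtype ∘ₗ (θ.symm : (TraceClass n ⧸ W) →ₗ[ℂ] X) ∘ₗ W.mkQ
  let x : Matrix (Fin n) (Fin n) V := (matrixUnits n).map ψ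
  have hψ : ∀ (k : ℕ) (σ : Matrix (Fin k) (Fin k) (TraceClass n)), slice σ x = σ.map ψ :=
    fun k σ => slice_map_matrixUnits ψ σ
  have hquot : ∀ (k : ℕ) (y : Matrix (Fin k) (Fin k) (TraceClass n)),
      mnorm k (y.map W.mkQ) ≤ mnorm k y := fun k y =>
    csInf_le ⟨0, fun r ⟨z, _, hz⟩ => hz ▸ mnorm_traceClass_nonneg z⟩ ⟨y, rfl, rfl⟩
  have hxb : ENNReal.ofReal (mnorm n x) ≤ cbNorm (θ.symm : (TraceClass n ⧸ W) →ₗ[ℂ] X) :=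
    le_cbNorm (θ.symm : (TraceClass n ⧸ W) →ₗ[ℂ] X) ((matrixUnits n).map W.mkQ)
      ((hquot _ _).trans (mnorm_matrixUnits_le n))
  have hlift : ∀ (k : ℕ) (q : Matrix (Fin k) (Fin k) (TraceClass n ⧸ W)),
      ∃ y : Matrix (Fin k) (Fin k) (TraceClass n), y.map W.mkQ = q := fun k q =>
    ⟨q.map (Function.surjInv W.mkQ_surjective), by
      ext i j; exact Function.surjInv_eq W.mkQ_surjective (q i j)⟩
  have hmap : ∀ (k : ℕ) (y : Matrix (Fin k) (Fin k) (TraceClass n))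
      (w : Matrix (Fin k) (Fin k) X), y.map W.mkQ = w.map θ →
      slice y x = w.map X.subtype := by
    intro k y w h
    rw [hψ]
    ext i j
    have hij : W.mkQ (y i j) = θ (w i j) := congrFun (congrFun h i) j
    simp [ψ, hij]
  -- If `x = 0`, every matrix over `X` is a slice of zero, so `X` is trivial; the size `1` only
  -- serves to keep the block size positive.
  rcases (mnorm_nonneg x).eq_or_lt with hr | hr
  · have hx0 : x = 0 := (OperatorSpace.mnorm_eq_zero n x).1 hr.symm
    refine ⟨1, 0, one_pos, by simp [mnorm_zero], fun k w d hw hd _ => ⟨0, ?_, ?_⟩⟩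
    · rw [mnorm_traceClass_zero]
      positivity
    · let w' : Matrix (Fin k) (Fin k) X := fun i j => ⟨w i j, hw i j⟩
      obtain ⟨y, hy⟩ := hlift k (w'.map θ)
      have := hmap k y w' hy
      rw [hx0, map_zero] at this
      rw [map_zero, this]
      rfl
  · set r := mnorm n x with hrdef
    have hn : 0 < n := by
      rcases Nat.eq_zero_or_pos n with rfl | h
      · have : x = 0 := Subsingleton.elim _ _
        rw [hrdef, this, mnorm_zero] at hr
        exact absurd hr (lt_irrefl _)
      · exact h
    have hr0 : ENNReal.ofReal r ≠ 0 := (ENNReal.ofReal_pos.2 hr).ne'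
    have har : cbNorm (θ : X →ₗ[ℂ] (TraceClass n ⧸ W)) * ENNReal.ofReal r < lam + 1 :=
      lt_of_le_of_lt (by gcongr) hθ
    have hlam1 : lam + 1 < ⊤ := ENNReal.add_lt_top.2 ⟨hlam, ENNReal.one_lt_top⟩
    set a := cbNorm (θ : X →ₗ[ℂ] (TraceClass n ⧸ W)) with hadef
    have hatop : a ≠ ⊤ := by
      intro h
      rw [h, ENNReal.top_mul hr0] at har
      exact absurd har (not_lt.2 le_top)
    have har' : a.toReal * r ≤ lam.toReal + 1 := by
      have := ENNReal.toReal_mono hlam1.ne har.le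
      rwa [ENNReal.toReal_mul, ENNReal.toReal_ofReal hr.le,
        ENNReal.toReal_add hlam.ne ENNReal.one_ne_top, ENNReal.toReal_one] at this
    -- Dividing by `r ≤ ‖θ⁻¹‖_cb` leaves only the product `‖θ‖_cb r ≤ λ + 1` in the estimate, not
    -- the separate norms.
    refine ⟨n, ((r⁻¹ : ℝ) : ℂ) • x, hn, ?_, fun k w d hw hd hwd => ?_⟩
    · rw [OperatorSpace.mnorm_smul, Complex.norm_real, norm_inv, Real.norm_of_nonneg hr.le,
        ← hrdef, inv_mul_cancel₀ hr.ne']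
    · let w' : Matrix (Fin k) (Fin k) X := fun i j => ((d⁻¹ : ℝ) : ℂ) • ⟨w i j, hw i j⟩
      have hw' : w'.map X.subtype = ((d⁻¹ : ℝ) : ℂ) • w := rfl
      have hw1 : mnorm k w' ≤ 1 := by
        change mnorm k (w'.map X.subtype) ≤ 1
        rw [hw', OperatorSpace.mnorm_smul, Complex.norm_real, norm_inv,
          Real.norm_of_nonneg hd.le]
        exact (inv_mul_le_one₀ hd).2 hwd
      have hq : mnorm k (w'.map θ) ≤ a.toReal :=
        (ENNReal.ofReal_le_iff_le_toReal hatop).1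
          (le_cbNorm (θ : X →ₗ[ℂ] (TraceClass n ⧸ W)) w' hw1)
      obtain ⟨y0, hy0⟩ := hlift k (w'.map θ)
      -- The quotient norm need not be known to be attained. The slack `r⁻¹` becomes `1` after
      -- multiplication by `r`, whence `λ + 2`.
      obtain ⟨_, ⟨y, hy, rfl⟩, hylt⟩ := exists_lt_of_csInf_lt
        (s := {s : ℝ | ∃ y : Matrix (Fin k) (Fin k) (TraceClass n),
          y.map W.mkQ = w'.map θ ∧ mnorm k y = s}) ⟨_, y0, hy0, rfl⟩
        (lt_of_le_of_lt hq (lt_add_of_pos_right _ (inv_pos.2 hr)))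
      refine ⟨((d * r : ℝ) : ℂ) • y, ?_, ?_⟩
      · refine (mnorm_traceClass_smul_le _ _).trans ?_
        rw [Complex.norm_real, Real.norm_of_nonneg (by positivity)]
        calc d * r * mnorm k y ≤ d * r * (a.toReal + r⁻¹) := by gcongr
          _ = (a.toReal * r + 1) * d := by field_simp
          _ ≤ (lam.toReal + 2) * d := by
            refine mul_le_mul_of_nonneg_right ?_ hd.le
            linarith
      · rw [slice_smul, LinearMap.smul_apply, map_smul, hmap k y w' hy, hw', smul_smul,
          smul_smul, ← Complex.ofReal_mul, ← Complex.ofReal_mul]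
        have : d * r * r⁻¹ * d⁻¹ = 1 := by field_simp
        rw [this, Complex.ofReal_one, one_smul]

end Coexact

/-! ### Finite and infinite block diagonal matrices. -/

section BlockDiagonal

/-- The size of the direct sum of the first blocks of given sizes. -/
def blockSize (n : ℕ → ℕ) : ℕ → ℕ
  | 0 => 0
  | J + 1 => blockSize n J + n J

theorem blockSize_mono (n : ℕ → ℕ) : Monotone (blockSize n) :=
  monotone_nat_of_le_succ fun _ => Nat.le_add_right _ _

theorem le_blockSize {n : ℕ → ℕ} (hn : ∀ j, 0 < n j) (J : ℕ) : J ≤ blockSize n J := by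
  induction J with
  | zero => exact Nat.zero_le _
  | succ J ih => exact add_le_add ih (hn J)

variable {V : Type*} [AddCommGroup V] {n : ℕ → ℕ}

/-- The direct sum of the first blocks of a sequence of square matrices. -/
def blockDiag (y : ∀ j, Matrix (Fin (n j)) (Fin (n j)) V) :
    ∀ J, Matrix (Fin (blockSize n J)) (Fin (blockSize n J)) V
  | 0 => 0
  | J + 1 => directSum (blockDiag y J) (y J)

/-- Appending blocks keeps earlier entries, so an infinite matrix can be read off from any
sufficiently long finite sum. -/
theorem blockDiag_coherent (y : ∀ j, Matrix (Fin (n j)) (Fin (n j)) V) {J J' : ℕ} (h : J ≤ J')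
    {p q : ℕ} (hp : p < blockSize n J) (hq : q < blockSize n J) (hp' : p < blockSize n J')
    (hq' : q < blockSize n J') :
    blockDiag y J' ⟨p, hp'⟩ ⟨q, hq'⟩ = blockDiag y J ⟨p, hp⟩ ⟨q, hq⟩ := by
  induction J', h using Nat.le_induction with
  | base => rfl
  | succ J' h ih =>
    have hp'' := hp.trans_le (blockSize_mono n h)
    have hq'' := hq.trans_le (blockSize_mono n h)
    rw [← ih hp'' hq'']
    exact directSum_castAdd_castAdd (blockDiag y J') (y J') ⟨p, hp''⟩ ⟨q, hq''⟩

theorem blockDiag_sub (y z : ∀ j, Matrix (Fin (n j)) (Fin (n j)) V) (J : ℕ) :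
    blockDiag (fun j => y j - z j) J = blockDiag y J - blockDiag z J := by
  induction J with
  | zero => simp [blockDiag]
  | succ J ih =>
    simp only [blockDiag, ih]
    exact directSum_sub _ _ _ _

theorem blockDiag_eq_zero (y : ∀ j, Matrix (Fin (n j)) (Fin (n j)) V) {J : ℕ}
    (hy : ∀ j, J ≤ j → y j = 0) (M : ℕ) (p q : Fin (blockSize n M))
    (h : blockSize n J ≤ p ∨ blockSize n J ≤ q) : blockDiag y M p q = 0 := by
  induction M with
  | zero => exact p.elim0
  | succ M ih =>
    revert h
    refine Fin.addCases (fun p => ?_) (fun p => ?_) p <;>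
      refine Fin.addCases (fun q => ?_) (fun q => ?_) q <;> intro h
    · simpa [blockDiag, directSum] using ih p q h
    · simp [blockDiag, directSum]
    · simp [blockDiag, directSum]
    -- An index in block `M` lies below `blockSize n J` when `M < J`.
    · have hM : J ≤ M := by
        by_contra hlt
        have h1 : blockSize n M + n M ≤ blockSize n J := blockSize_mono n (not_le.1 hlt)
        have h2 := p.2
        have h3 := q.2
        simp only [Fin.val_natAdd] at h
        omega
      simp [blockDiag, directSum, hy M hM]

/-- The infinite block diagonal matrix with given blocks of positive sizes. -/
def infBlockDiag (hn : ∀ j, 0 < n j) (y : ∀ j, Matrix (Fin (n j)) (Fin (n j)) V) :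
    Matrix ℕ ℕ V := fun p q =>
  blockDiag y (max p q + 1)
    ⟨p, lt_of_lt_of_le (Nat.lt_succ_of_le (le_max_left p q)) (le_blockSize hn _)⟩
    ⟨q, lt_of_lt_of_le (Nat.lt_succ_of_le (le_max_right p q)) (le_blockSize hn _)⟩

theorem block_infBlockDiag (hn : ∀ j, 0 < n j) (y : ∀ j, Matrix (Fin (n j)) (Fin (n j)) V)
    (J : ℕ) : block (blockSize n J) (infBlockDiag hn y) = blockDiag y J := by
  ext p q
  rcases le_total J (max (p : ℕ) q + 1) with h | h
  · exact blockDiag_coherent y h p.2 q.2 _ _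
  · exact (blockDiag_coherent y h _ _ p.2 q.2).symm

theorem infBlockDiag_sub (hn : ∀ j, 0 < n j) (y z : ∀ j, Matrix (Fin (n j)) (Fin (n j)) V) :
    infBlockDiag hn (fun j => y j - z j) = infBlockDiag hn y - infBlockDiag hn z := by
  ext p q
  simp [infBlockDiag, blockDiag_sub]

theorem exists_slice_blockDiag [Module ℂ V] (y : ∀ j, Matrix (Fin (n j)) (Fin (n j)) V) {k : ℕ}
    (σ : ∀ j, Matrix (Fin k) (Fin k) (TraceClass (n j))) (J : ℕ) :
    ∃ τ : Matrix (Fin k) (Fin k) (TraceClass (blockSize n J)),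
      mnorm k τ ≤ ∑ j ∈ Finset.range J, mnorm k (σ j) ∧
      slice τ (blockDiag y J) = ∑ j ∈ Finset.range J, slice (σ j) (y j) := by
  induction J with
  | zero => exact ⟨0, by simp [mnorm_traceClass_zero], by simp [slice_zero]⟩
  | succ J ih =>
    obtain ⟨τ, h1, h2⟩ := ih
    refine ⟨traceSum τ (σ J), ?_, ?_⟩
    · rw [Finset.sum_range_succ]
      exact (mnorm_traceSum_le _ _).trans (by gcongr)
    · rw [Finset.sum_range_succ, ← h2]
      refine (slice_traceSum _ _ _).trans ?_
      congr 2
      · ext i j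
        exact directSum_castAdd_castAdd _ _ i j
      · ext i j
        exact directSum_natAdd_natAdd _ _ i j

end BlockDiagonal

/-! ### Block diagonal matrices in `𝒦(V)`. -/

section CompactMatrices

variable {V : Type*} [AddCommGroup V] [Module ℂ V] [OperatorSpace V] {n : ℕ → ℕ}

theorem mnorm_blockDiag_le (y : ∀ j, Matrix (Fin (n j)) (Fin (n j)) V) {r : ℝ} (hr : 0 ≤ r)
    (hy : ∀ j, mnorm (n j) (y j) ≤ r) (J : ℕ) : mnorm (blockSize n J) (blockDiag y J) ≤ r := by
  induction J with
  | zero =>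
    have : blockDiag y 0 = 0 := rfl
    rw [this, mnorm_zero]
    exact hr
  | succ J ih =>
    exact (OperatorSpace.mnorm_directSum _ _ (blockDiag y J) (y J)).trans_le (max_le ih (hy J))

/-- Cutting off after finitely many blocks leaves a tail whose norm is at most the supremum of the
remaining block norms. -/
theorem infBlockDiag_mem_compactMatrices (hn : ∀ j, 0 < n j)
    (y : ∀ j, Matrix (Fin (n j)) (Fin (n j)) V)
    (hy : Filter.Tendsto (fun j => mnorm (n j) (y j)) Filter.atTop (nhds 0)) :
    infBlockDiag hn y ∈ compactMatrices V := by
  intro ε hε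
  obtain ⟨J, hJ⟩ := Filter.eventually_atTop.1 (hy.eventually (gt_mem_nhds hε))
  let z : ∀ j, Matrix (Fin (n j)) (Fin (n j)) V := fun j => if j < J then y j else 0
  refine ⟨infBlockDiag hn z, ⟨blockSize n J, fun p q h => ?_⟩, fun N => ?_⟩
  · exact blockDiag_eq_zero z (fun j hj => if_neg (not_lt.2 hj)) _ _ _ h
  · rw [← infBlockDiag_sub]
    -- Enlarging the corner to the end of block `N` avoids cutting through a block.
    refine (mnorm_block_mono _ (le_blockSize hn N)).trans ?_
    rw [block_infBlockDiag]
    refine mnorm_blockDiag_le _ hε.le (fun j => ?_) N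
    by_cases hj : j < J
    · simp [z, hj, mnorm_zero, hε.le]
    · simpa [z, hj] using (hJ j (not_lt.1 hj)).le

end CompactMatrices

end OpSp

/-! ### Telescoping decomposition and the main theorem. -/

open OpSp MatrixNorm in
theorem OpSp.MatrixSet.IsCompletelyCompact.exists_telescoping {V : Type*} [AddCommGroup V]
    [Module ℂ V] [OperatorSpace V] {lam : ℝ≥0∞} (hV : IsSubcoexact lam V) {K : MatrixSet V}
    (hK : K.IsCompletelyCompact) :
    ∃ (X : ℕ → Submodule ℂ V) (R : ℝ), 0 < R ∧ (∀ j, IsCoexact lam (X j)) ∧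
      ∀ k, ∀ v ∈ K k, ∃ w : ℕ → Matrix (Fin k) (Fin k) V,
        (∀ j p q, w j p q ∈ X j) ∧ (∀ j, mnorm k (w j) ≤ R * (1 / 4) ^ j) ∧
        ∀ J, mnorm k (v - ∑ j ∈ Finset.range (J + 1), w j) < (1 / 4) ^ J := by
  obtain ⟨_, ⟨C, hC⟩, hF⟩ := hK
  choose F hFfin hFK using fun j : ℕ => hF ((1 / 4) ^ j) (by positivity)
  -- `X j` must contain the difference of consecutive approximants; at `j = 0` truncated subtraction
  -- gives just `F 0`.
  choose X hFX hXfin hX using fun j : ℕ => hV (F (j - 1) ⊔ F j)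
    (by have := hFfin (j - 1); have := hFfin j; infer_instance)
  -- The first term needs `|C| + 1` and the later ones `5`, since `4⁻ʲ + 4⁻⁽ʲ⁺¹⁾ = 5 · 4⁻⁽ʲ⁺¹⁾`; `9`
  -- is a generous choice.
  refine ⟨X, |C| + 9, by positivity, hX, fun k v hv => ?_⟩
  choose u huF huv using fun j => hFK j k v hv
  let w : ℕ → Matrix (Fin k) (Fin k) V := fun j => if j = 0 then u 0 else u j - u (j - 1)
  have hsum : ∀ J, ∑ j ∈ Finset.range (J + 1), w j = u J := by
    intro J
    induction J with
    | zero => simp [w]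
    | succ J ih => rw [Finset.sum_range_succ, ih]; simp [w]
  have htri : ∀ x y : Matrix (Fin k) (Fin k) V, mnorm k (x - y) ≤ mnorm k x + mnorm k y := by
    intro x y
    rw [sub_eq_add_neg, ← mnorm_neg y]
    exact OperatorSpace.mnorm_add_le k x (-y)
  refine ⟨w, fun j p q => ?_, fun j => ?_, fun J => by rw [hsum]; exact huv J⟩
  · apply hFX j
    rcases j with _ | j
    · exact Submodule.mem_sup_right (huF 0 p q)
    · exact Submodule.sub_mem _ (Submodule.mem_sup_right (huF (j + 1) p q))
        (Submodule.mem_sup_left (huF j p q))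
  · rcases j with _ | j
    · have h1 := htri v (v - u 0)
      have h2 := huv 0
      have h3 := (hC k v hv).trans (le_abs_self C)
      rw [sub_sub_cancel] at h1
      simp only [w, if_true, pow_zero, mul_one] at h2 ⊢
      linarith
    · have h1 := htri (v - u j) (v - u (j + 1))
      have h2 := huv j
      have h3 := huv (j + 1)
      rw [sub_sub_sub_cancel_left] at h1
      have h4 : w (j + 1) = u (j + 1) - u j := by simp [w]
      rw [h4]
      rw [pow_succ] at h3 ⊢
      have h5 : (0 : ℝ) < (1 / 4) ^ j := by positivity
      nlinarith [mul_nonneg (abs_nonneg C) h5.le]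

open OpSp MatrixNorm in
theorem mainTheorem3 {V : Type*} [AddCommGroup V] [Module ℂ V] [OpSp.OperatorSpace V]
    (lam : ℝ≥0∞) (hlam : lam < ⊤) (hV : OpSp.IsSubcoexact lam V)
    (K : OpSp.MatrixSet V) (hK : K.IsCompletelyCompact) :
    K.IsOperatorCompact := by
  obtain ⟨X, R, hR, hX, hw⟩ := hK.exists_telescoping hV
  choose n x hn hx hslice using fun j => exists_slice_of_isCoexact hlam (X j) (hX j)
  set L : ℝ := lam.toReal + 2
  have hL : 0 < L := by positivity
  -- The bound `L R 4⁻ʲ` on `σ j` divided by `c j` is `(1/2) 2⁻ʲ`, which sums to at most `1`, while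
  -- `c j` still tends to `0`.
  let c : ℕ → ℝ := fun j => 2 * L * R * (1 / 2) ^ j
  have hc : ∀ j, 0 < c j := fun j => by positivity
  let y : ∀ j, Matrix (Fin (n j)) (Fin (n j)) V := fun j => (c j : ℂ) • x j
  have hy : Filter.Tendsto (fun j => mnorm (n j) (y j)) Filter.atTop (nhds 0) := by
    have hc0 : Filter.Tendsto c Filter.atTop (nhds 0) := by
      simpa only [mul_zero] using (tendsto_pow_atTop_nhds_zero_of_lt_one (r := (1 / 2 : ℝ)) (by norm_num)
        (by norm_num)).const_mul (2 * L * R)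
    refine squeeze_zero (fun j => mnorm_nonneg _) (fun j => ?_) hc0
    rw [OperatorSpace.mnorm_smul, Complex.norm_real, Real.norm_of_nonneg (hc j).le]
    exact mul_le_of_le_one_right (hc j).le (hx j)
  refine ⟨hK.1, infBlockDiag hn y, infBlockDiag_mem_compactMatrices hn y hy,
    fun k v hv ε hε => ?_⟩
  obtain ⟨w, hwX, hwR, hwv⟩ := hw k v hv
  choose σ hσ hσw using fun j =>
    hslice j k (w j) (R * (1 / 4) ^ j) (hwX j) (by positivity) (hwR j)
  obtain ⟨J, hJ⟩ := exists_pow_lt_of_lt_one hε (by norm_num : (1 / 4 : ℝ) < 1)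
  obtain ⟨τ, hτ, hτy⟩ := exists_slice_blockDiag y (fun j => ((c j)⁻¹ : ℂ) • σ j) (J + 1)
  refine ⟨_, ⟨blockSize n (J + 1), τ, hτ.trans ?_, rfl⟩, ?_⟩
  · have hterm : ∀ j, mnorm k (((c j)⁻¹ : ℂ) • σ j) ≤ (1 / 2) * (1 / 2) ^ j := by
      intro j
      refine (mnorm_traceClass_smul_le _ _).trans ?_
      rw [norm_inv, Complex.norm_real, Real.norm_of_nonneg (hc j).le, inv_mul_le_iff₀ (hc j)]
      refine (hσ j).trans (le_of_eq ?_)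
      have : (1 / 4 : ℝ) ^ j = (1 / 2) ^ j * (1 / 2) ^ j := by rw [← mul_pow]; norm_num
      simp only [c, this]
      ring
    refine (Finset.sum_le_sum fun j _ => hterm j).trans ?_
    rw [← Finset.mul_sum]
    have := sum_geometric_two_le (J + 1)
    linarith
  · rw [block_infBlockDiag, hτy]
    refine lt_of_eq_of_lt ?_ ((hwv J).trans hJ)
    congr 2
    refine Finset.sum_congr rfl fun j _ => ?_
    have : (c j : ℂ) ≠ 0 := Complex.ofReal_ne_zero.2 (hc j).ne'
    rw [slice_smul, LinearMap.smul_apply, map_smul, smul_smul, inv_mul_cancel₀ this, one_smul,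
      hσw]
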